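/- Let $j,k,n$ be positive integers with $j\le k$. Let $P^{(j)}_{n,k}$ be the hypergraph on the vertex set $V=\{v_1,\dots,v_n\}$ obtained from the $k$-uniform tight path $P_{n,k}=\{\{v_{i+1},\dots,v_{i+k}\}:0\le i\le n-k\}$ by deleting the edge $\{v_{n-k+1},\dots,v_n\}$ if it exists (that is, if $n\ge k$), and then adding the edge $\{v_{n-j+1},\dots,v_n\}$ if $n\ge j$. For a hypergraph $\mathcal H$ on $V$, let $\mathrm{NC}(\mathcal H)$ be its noncover complex, the abstract simplicial complex whose faces are the sets $W\subseteq V$ that fail to meet some edge of $\mathcal H$. If $n<j$, then $\mathrm{NC}(P^{(j)}_{n,k})=\emptyset$ is the void complex (it has no face, not even $\emptyset$). If $n\ge j$, then for integers $q\ge 0$ \[ \mathrm{NC}(P^{(j)}_{n,k})\simeq \begin{cases} S^{2q} & \text{if } n=(q+1)(k+1),\\ S^{2q-1} & \text{if } n=q(k+1)+j,\\ * & \text{if } n \text{ is of neither form for any } q\ge 0, \end{cases} \] where $\simeq$ denotes homotopy equivalence of the geometric realization, $*$ means that it is contractible, and $S^{-1}$ is the empty complex $\{\emptyset\}$; that is,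 for $n=j$ one has $\mathrm{NC}(P^{(j)}_{n,k})=\{\emptyset\}$. -/

import Mathlib

open scoped ContinuousMap

/-- A cover of a hypergraph: a set of vertices that meets every edge. -/
def Hypergraph.IsCover {V : Type*} (H : Hypergraph V) (W : Set V) : Prop :=
  W ⊆ H.vertexSet ∧ ∀ e ∈ H.edgeSet, (W ∩ e).Nonempty

/-- The noncover complex of a hypergraph: the finite sets of vertices that are not covers.

An abstract simplicial complex on `V` is a family of finite subsets of `V` closed under taking
subsets, that is, an element of `LowerSet (Finset V)`. The empty set may or may not be a face:
the void complex is `⊥` (no face at all), and the empty complex is the one whose only face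
is `∅`. -/
def Hypergraph.noncoverComplex {V : Type*} (H : Hypergraph V) : LowerSet (Finset V) where
  carrier := {W | (W : Set V) ⊆ H.vertexSet ∧ ¬ H.IsCover (W : Set V)}
  lower' := by
    rintro W W' hle ⟨hW, hnc⟩
    have hsub : (W' : Set V) ⊆ (W : Set V) := Finset.coe_subset.mpr hle
    refine ⟨hsub.trans hW, fun hc => hnc ⟨hW, fun e he => ?_⟩⟩
    exact (hc.2 e he).mono (Set.inter_subset_inter_left e hsub)

/-- The geometric realization of an abstract simplicial complex on a finite set `V`: the points of
the standard simplex on `V` whose support lies in a face, as a subspace of `ℝ^V`. -/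
def geometricRealization {V : Type*} [Fintype V] (K : LowerSet (Finset V)) : Set (V → ℝ) :=
  {x | x ∈ stdSimplex ℝ V ∧ ∃ s ∈ K, Function.support x ⊆ (s : Set V)}

/-- The block `{v_{i+1}, …, v_{i+m}}` of `{v_1, …, v_n}`, where `v_{a+1}` is `a : Fin n`. -/
def block (n i m : ℕ) : Set (Fin n) :=
  {v | i ≤ (v : ℕ) ∧ (v : ℕ) < i + m}

/-- The `k`-uniform tight path `P_{n,k}` on `{v_1, …, v_n}`: its edges are the blocks
`{v_{i+1}, …, v_{i+k}}` for `0 ≤ i ≤ n - k`. -/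
def tightPath (n k : ℕ) : Hypergraph (Fin n) where
  vertexSet := Set.univ
  edgeSet := {e | ∃ i : ℕ, i + k ≤ n ∧ e = block n i k}
  subset_vertexSet_of_mem_edgeSet' := fun _ _ => Set.subset_univ _

/-- The generalized tight path `P_{n,k}^{(j)}`: from `P_{n,k}`, the edge `{v_{n-k+1}, …, v_n}` is
deleted if it exists, and then the edge `{v_{n-j+1}, …, v_n}` is added if `j ≤ n`. -/
def generalizedTightPath (n k j : ℕ) : Hypergraph (Fin n) where
  vertexSet := Set.univ
  edgeSet := ((tightPath n k).edgeSet \ {e | k ≤ n ∧ e = block n (n - k) k}) ∪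
    {e | j ≤ n ∧ e = block n (n - j) j}
  subset_vertexSet_of_mem_edgeSet' := fun _ _ => Set.subset_univ _

/-- The unit sphere of `ℝ^d`. It is the sphere `S^{d-1}`; for `d = 0` it is empty. -/
abbrev unitSphere (d : ℕ) : Set (EuclideanSpace ℝ (Fin d)) :=
  Metric.sphere 0 1

/-! The realization of a noncover complex is the union of the simplex faces spanned by the
complements of the edges. For n > k, split that of P^{(j)}_{n,k} as A ∪ B, where A collects the
complements of the remaining k-blocks, all containing v_n, and B is the simplex on the first n - j
vertices. Then A ∩ B is the realization for the parameters (n - j, k + 1 - j)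
(`blockComplements_inter_initialFace`), and A ∪ B is its suspension up to homotopy. Each such step
exchanges the forms n = (q+1)(k+1) and n = q(k+1) + j. The recursion ends at n = j, where the
realization is empty, or at j < n ≤ k, where it is a simplex.

The gluing rests on absolute extensors. Faces and hemispheres are retracts of Euclidean spaces,
hence extensors by Tietze, and a union of two closed extensors is one if their intersection is. Maps
and homotopies given on A ∩ B extend over A and over B separately, so the homotopy type of A ∪ B
depends only on that of A ∩ B (`nonempty_homotopyEquiv_union`). Comparison with two hemispheres
meeting in the equator gives the spheres. -/

/-! ### Absolute extensors -/

/-- A set `S` in a space `E` is an absolute extensor (for metric spaces) if every continuous map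
into `S` from a closed subset of a metric space extends to the whole metric space. -/
def IsAbsoluteExtensor {E : Type} [TopologicalSpace E] (S : Set E) : Prop :=
  ∀ (Z : Type) [MetricSpace Z] (D : Set Z) (f : Z → E), IsClosed D → ContinuousOn f D →
    Set.MapsTo f D S → ∃ g : Z → E, Continuous g ∧ (∀ z, g z ∈ S) ∧ Set.EqOn g f D

namespace IsAbsoluteExtensor

theorem of_retraction {E : Type} [TopologicalSpace E] [TietzeExtension.{0} E] {S : Set E}
    (r : E → E) (hr : Continuous r) (hS : ∀ x, r x ∈ S) (hid : ∀ x ∈ S, r x = x) :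
    IsAbsoluteExtensor S := by
  intro Z _ D f hD hf hfS
  obtain ⟨g, hg⟩ := ContinuousMap.exists_restrict_eq hD
    (⟨D.domRestrict f, continuousOn_iff_continuous_domRestrict.mp hf⟩ : C(D, E))
  refine ⟨fun z => r (g z), hr.comp g.continuous, fun z => hS _, fun z hz => ?_⟩
  have : g z = f z := DFunLike.congr_fun hg ⟨z, hz⟩
  simp only [this, hid _ (hfS hz)]

/-- Maps into two absolute extensors, prescribed on a closed set `T` and on the intersection of two
closed sets `P` and `Q`, extend to `P ∪ Q`. -/
theorem exists_extend_union {E Z : Type} [TopologicalSpace E] [MetricSpace Z] {P Q T : Set Z}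
    {A B : Set E} (hA : IsAbsoluteExtensor A) (hB : IsAbsoluteExtensor B) (hP : IsClosed P)
    (hQ : IsClosed Q) (hT : IsClosed T) (f : Z → E) (hf : ContinuousOn f (P ∩ Q ∪ T))
    (hfA : Set.MapsTo f (P ∩ (Q ∪ T)) A) (hfB : Set.MapsTo f (Q ∩ (P ∪ T)) B) :
    ∃ F : Z → E, ContinuousOn F (P ∪ Q) ∧ Set.MapsTo F P A ∧ Set.MapsTo F Q B ∧
      Set.EqOn F f ((P ∪ Q) ∩ (P ∩ Q ∪ T)) := by
  classical
  obtain ⟨a, ha, haA, haf⟩ := hA Z (P ∩ (Q ∪ T)) f (hP.inter (hQ.union hT))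
    (hf.mono (by intro z; simp; tauto)) hfA
  obtain ⟨b, hb, hbB, hbf⟩ := hB Z (Q ∩ (P ∪ T)) f (hQ.inter (hP.union hT))
    (hf.mono (by intro z; simp; tauto)) hfB
  have hab : ∀ z ∈ Q, (if z ∈ P then a z else b z) = b z := by
    intro z hz
    split_ifs with h
    · rw [haf ⟨h, .inl hz⟩, hbf ⟨hz, .inl h⟩]
    · rfl
  refine ⟨fun z => if z ∈ P then a z else b z, ?_, ?_, ?_, ?_⟩
  · refine ContinuousOn.union_of_isClosed ?_ ?_ hP hQ
    · exact ha.continuousOn.congr fun z hz => if_pos hz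
    · exact hb.continuousOn.congr hab
  · intro z hz
    simpa only [if_pos hz] using haA z
  · intro z hz
    simpa only [hab z hz] using hbB z
  · rintro z ⟨hz, hz'⟩
    by_cases h : z ∈ P
    · simp only [if_pos h]
      exact haf ⟨h, hz'.imp (fun h => h.2) id⟩
    · have hzQ := hz.resolve_left h
      simp only [if_neg h]
      exact hbf ⟨hzQ, hz'.imp (fun h => h.1) id⟩

/-- Cut Z into the points nearer to f⁻¹(A) and those nearer to f⁻¹(B). On the common boundary map
into A ∩ B, then extend over each half into A or B. -/
theorem union {E : Type} [TopologicalSpace E] {A B : Set E} (hA : IsAbsoluteExtensor A)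
    (hB : IsAbsoluteExtensor B) (hAB : IsAbsoluteExtensor (A ∩ B)) (cA : IsClosed A)
    (cB : IsClosed B) : IsAbsoluteExtensor (A ∪ B) := by
  classical
  intro Z _ D f hD hf hfS
  set DA := D ∩ f ⁻¹' A
  set DB := D ∩ f ⁻¹' B
  have hDA : IsClosed DA := hf.preimage_isClosed_of_isClosed hD cA
  have hDB : IsClosed DB := hf.preimage_isClosed_of_isClosed hD cB
  obtain ⟨g, hg, hgAB, hgf⟩ := hAB Z (DA ∩ DB) f (hDA.inter hDB)
    (hf.mono fun z hz => hz.1.1) fun z hz => ⟨hz.1.2, hz.2.2⟩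
  set P := {z | Metric.infEDist z DA ≤ Metric.infEDist z DB}
  set Q := {z | Metric.infEDist z DB ≤ Metric.infEDist z DA}
  have hP : IsClosed P := isClosed_le Metric.continuous_infEDist Metric.continuous_infEDist
  have hQ : IsClosed Q := isClosed_le Metric.continuous_infEDist Metric.continuous_infEDist
  have hPQ : P ∪ Q = Set.univ := Set.eq_univ_of_forall fun z =>
    le_total (Metric.infEDist z DA) (Metric.infEDist z DB)
  -- The extended distance matters: it is `⊤` to an empty set, whereas `Metric.infDist` would be 0
  -- there.
  have key : ∀ {S T : Set Z}, IsClosed S → ∀ {z}, z ∈ S ∪ T →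
      Metric.infEDist z S ≤ Metric.infEDist z T → z ∈ S := by
    rintro S T hS z (hz | hz) hle
    · exact hz
    · rw [← hS.closure_eq, Metric.mem_closure_iff_infEDist_zero]
      exact le_antisymm (hle.trans (Metric.infEDist_zero_of_mem hz).le) bot_le
  have hDAB : ∀ z ∈ D, z ∈ DA ∪ DB := fun z hz =>
    (hfS hz).imp (fun h => ⟨hz, h⟩) (fun h => ⟨hz, h⟩)
  have hPD : ∀ z ∈ D, z ∈ P → z ∈ DA := fun z hz h => key hDA (hDAB z hz) h
  have hQD : ∀ z ∈ D, z ∈ Q → z ∈ DB := fun z hz h => key hDB (hDAB z hz).symm h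
  have hfg : ∀ z ∈ P ∩ Q, (if z ∈ D then f z else g z) = g z := by
    intro z hz
    split_ifs with h
    · exact (hgf ⟨hPD z h hz.1, hQD z h hz.2⟩).symm
    · rfl
  obtain ⟨F, hF, hFA, hFB, hFf⟩ := exists_extend_union hA hB hP hQ hD
    (fun z => if z ∈ D then f z else g z)
    ((hg.continuousOn.congr hfg).union_of_isClosed (hf.congr fun z hz => if_pos hz)
      (hP.inter hQ) hD)
    (by
      rintro z ⟨hz, hz'⟩
      by_cases h : z ∈ D
      · simp only [if_pos h]
        exact (hPD z h hz).2
      · simpa only [if_neg h] using (hgAB z).1)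
    (by
      rintro z ⟨hz, hz'⟩
      by_cases h : z ∈ D
      · simp only [if_pos h]
        exact (hQD z h hz).2
      · simpa only [if_neg h] using (hgAB z).2)
  rw [hPQ] at hF hFf
  refine ⟨F, continuousOn_univ.mp hF, fun z => ?_, fun z hz => ?_⟩
  · have : z ∈ P ∪ Q := hPQ ▸ Set.mem_univ z
    exact this.imp (fun h => hFA h) (fun h => hFB h)
  · rw [hFf ⟨trivial, .inr hz⟩]
    exact if_pos hz

/-- A contraction is an extension of the map that is the identity on S × {0} and constant on S ×
{1}. -/
theorem contractibleSpace {E : Type} [MetricSpace E] {S : Set E} (hS : IsAbsoluteExtensor S)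
    (cS : IsClosed S) (hne : S.Nonempty) : ContractibleSpace S := by
  classical
  obtain ⟨p, hp⟩ := hne
  obtain ⟨H, hH, hHS, hHf⟩ := hS (E × ℝ) (S ×ˢ {0} ∪ S ×ˢ {1})
    (fun z => if z.2 ≤ 0 then z.1 else p)
    ((cS.prod isClosed_singleton).union (cS.prod isClosed_singleton))
    (ContinuousOn.union_of_isClosed
      (continuous_fst.continuousOn.congr fun z hz => if_pos (le_of_eq hz.2))
      ((continuousOn_const (c := p)).congr (by
        rintro ⟨x, t⟩ ⟨-, rfl⟩
        exact if_neg (not_le.mpr one_pos)))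
      (cS.prod isClosed_singleton) (cS.prod isClosed_singleton))
    (by
      intro z hz
      dsimp only
      split_ifs
      · exact hz.elim (fun h => h.1) (fun h => h.1)
      · exact hp)
  rw [contractible_iff_id_nullhomotopic]
  refine ⟨⟨p, hp⟩, ⟨⟨⟨fun z => ⟨H (z.2, z.1), hHS _⟩, by fun_prop⟩, ?_, ?_⟩⟩⟩
  · intro x
    ext1
    have := hHf (x := ((x : E), (0 : ℝ))) (.inl ⟨x.2, rfl⟩)
    simpa using this
  · intro x
    ext1
    have := hHf (x := ((x : E), (1 : ℝ))) (.inr ⟨x.2, rfl⟩)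
    simpa [not_le.mpr (one_pos (α := ℝ))] using this

end IsAbsoluteExtensor

/-! ### Homotopy type of a union of two extensors -/

theorem ContinuousMap.exists_continuousOn_extension {E E' : Type*} [TopologicalSpace E]
    [TopologicalSpace E'] [Nonempty E'] {C : Set E} {C' : Set E'} (φ : C(C, C')) :
    ∃ f : E → E', ContinuousOn f C ∧ ∀ x : C, f x = φ x := by
  classical
  refine ⟨Function.extend Subtype.val (fun x => (φ x : E')) fun _ => Classical.arbitrary E',
    ?_, fun x => Subtype.val_injective.extend_apply _ _ x⟩
  rw [continuousOn_iff_continuous_domRestrict]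
  convert continuous_subtype_val.comp φ.continuous using 1
  ext x
  exact Subtype.val_injective.extend_apply _ _ x

/-- A self-map of `A ∪ B` that preserves the two absolute extensors `A` and `B` and is homotopic to
the identity on `A ∩ B` is homotopic to the identity. -/
theorem homotopic_id_of_union {E : Type} [MetricSpace E] {A B : Set E}
    (hA : IsAbsoluteExtensor A) (hB : IsAbsoluteExtensor B) (cA : IsClosed A) (cB : IsClosed B)
    (F : C(↥(A ∪ B), ↥(A ∪ B))) (φ : C(↥(A ∩ B), ↥(A ∩ B)))
    (hFA : ∀ x : ↥(A ∪ B), (x : E) ∈ A → (F x : E) ∈ A)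
    (hFB : ∀ x : ↥(A ∪ B), (x : E) ∈ B → (F x : E) ∈ B)
    (hFφ : ∀ x : ↥(A ∩ B), (F ⟨x, .inl x.2.1⟩ : E) = φ x)
    (hφ : φ.Homotopic (ContinuousMap.id _)) : F.Homotopic (ContinuousMap.id _) := by
  classical
  rcases isEmpty_or_nonempty E with hE | hE
  · have : F = ContinuousMap.id _ := by ext x; exact hE.elim x
    exact this ▸ ContinuousMap.Homotopic.refl _
  obtain ⟨h⟩ := hφ
  obtain ⟨f, hf, hfF⟩ := F.exists_continuousOn_extension
  have hI : IsClosed (Set.Icc (0 : ℝ) 1) := isClosed_Icc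
  set P : Set (E × ℝ) := A ×ˢ Set.Icc 0 1
  set Q : Set (E × ℝ) := B ×ˢ Set.Icc 0 1
  have hP : IsClosed P := cA.prod hI
  have hQ : IsClosed Q := cB.prod hI
  have hX : IsClosed (A ∪ B) := cA.union cB
  obtain ⟨k, hk, hkh⟩ : ∃ k : E × ℝ → E, ContinuousOn k (P ∩ Q) ∧
      ∀ (x : ↥(A ∩ B)) (t : unitInterval), k (x, t) = h (t, x) := by
    let ψ : C(↥(P ∩ Q), ↥(A ∩ B)) :=
      ⟨fun z => h (⟨z.1.2, z.2.1.2⟩, ⟨z.1.1, z.2.1.1, z.2.2.1⟩), by fun_prop⟩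
    obtain ⟨k, hk, hkψ⟩ := ψ.exists_continuousOn_extension
    exact ⟨k, hk, fun x t => hkψ ⟨(x, t), ⟨x.2.1, t.2⟩, ⟨x.2.2, t.2⟩⟩⟩
  have hk0 : ∀ x ∈ A ∩ B, k (x, 0) = f x := by
    intro x hx
    rw [hfF ⟨x, .inl hx.1⟩, hFφ ⟨x, hx⟩]
    simpa using hkh ⟨x, hx⟩ 0
  have hk1 : ∀ x ∈ A ∩ B, k (x, 1) = x := by
    intro x hx
    simpa using hkh ⟨x, hx⟩ 1
  -- The data to extend over (A ∪ B) × [0, 1]: F at the bottom, the identity at the top, and the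
  -- given homotopy on the walls over A ∩ B.
  let u : E × ℝ → E := fun z => if z.2 ≤ 0 then f z.1 else if 1 ≤ z.2 then z.1 else k z
  have hu0 : ∀ x, u (x, 0) = f x := fun x => if_pos le_rfl
  have hu1 : ∀ x, u (x, 1) = x := fun x => by simp [u, not_le.mpr one_pos]
  have huk : ∀ z ∈ P ∩ Q, u z = k z := by
    rintro ⟨x, t⟩ ⟨⟨hxA, h0, h1⟩, hxB, -⟩
    dsimp only at hxA hxB h0 h1
    simp only [u]
    split_ifs with ha hb
    · obtain rfl := le_antisymm ha h0
      exact (hk0 x ⟨hxA, hxB⟩).symm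
    · obtain rfl := le_antisymm h1 hb
      exact (hk1 x ⟨hxA, hxB⟩).symm
    · rfl
  have hu_mem : ∀ z ∈ P ∩ Q, u z ∈ A ∩ B := by
    intro z hz
    rw [huk z hz]
    have := hkh ⟨z.1, hz.1.1, hz.2.1⟩ ⟨z.2, hz.1.2⟩
    have e : k z = (h (⟨z.2, hz.1.2⟩, ⟨z.1, hz.1.1, hz.2.1⟩) : E) := this
    rw [e]
    exact Subtype.coe_prop _
  have hT0 : IsClosed ((A ∪ B) ×ˢ {(0 : ℝ)}) := hX.prod isClosed_singleton
  have hT1 : IsClosed ((A ∪ B) ×ˢ {(1 : ℝ)}) := hX.prod isClosed_singleton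
  have hu : ContinuousOn u (P ∩ Q ∪ ((A ∪ B) ×ˢ {0} ∪ (A ∪ B) ×ˢ {1})) := by
    refine (hk.congr huk).union_of_isClosed (ContinuousOn.union_of_isClosed ?_ ?_ hT0 hT1)
      (hP.inter hQ) (hT0.union hT1)
    · refine (hf.comp continuous_fst.continuousOn fun z hz => hz.1).congr ?_
      rintro ⟨x, t⟩ ⟨-, rfl⟩
      exact hu0 x
    · refine continuous_fst.continuousOn.congr ?_
      rintro ⟨x, t⟩ ⟨-, rfl⟩
      exact hu1 x
  obtain ⟨H, hH, hHA, hHB, hHu⟩ := IsAbsoluteExtensor.exists_extend_union hA hB hP hQ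
    (hT0.union hT1) u hu
    (by
      rintro ⟨x, t⟩ ⟨hz, hz' | ⟨-, rfl⟩ | ⟨-, rfl⟩⟩
      · exact (hu_mem _ ⟨hz, hz'⟩).1
      · rw [hu0, hfF ⟨x, .inl hz.1⟩]
        exact hFA _ hz.1
      · rw [hu1]
        exact hz.1)
    (by
      rintro ⟨x, t⟩ ⟨hz, hz' | ⟨-, rfl⟩ | ⟨-, rfl⟩⟩
      · exact (hu_mem _ ⟨hz', hz⟩).2
      · rw [hu0, hfF ⟨x, .inr hz.1⟩]
        exact hFB _ hz.1
      · rw [hu1]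
        exact hz.1)
  have hmem : ∀ z : unitInterval × ↥(A ∪ B), ((z.2 : E), (z.1 : ℝ)) ∈ P ∪ Q := fun z =>
    z.2.2.imp (fun h => ⟨h, z.1.2⟩) (fun h => ⟨h, z.1.2⟩)
  refine ⟨⟨⟨fun z => ⟨H (z.2, z.1), (hmem z).imp (fun h => hHA h) (fun h => hHB h)⟩, ?_⟩,
    ?_, ?_⟩⟩
  · exact (hH.comp_continuous (by fun_prop) hmem).subtype_mk _
  · intro x
    ext1
    change H (x, ((0 : unitInterval) : ℝ)) = F x
    rw [hHu ⟨hmem (0, x), .inr (.inl ⟨x.2, rfl⟩)⟩, ← hfF]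
    exact hu0 x
  · intro x
    ext1
    change H (x, ((1 : unitInterval) : ℝ)) = x
    rw [hHu ⟨hmem (1, x), .inr (.inr ⟨x.2, rfl⟩)⟩]
    exact hu1 x

/-- A map between the intersections of two pairs of absolute extensors extends to the unions. -/
theorem exists_extend_union_of_inter {E E' : Type} [MetricSpace E] [TopologicalSpace E']
    [Nonempty E'] {A B : Set E} {A' B' : Set E'} (hA' : IsAbsoluteExtensor A')
    (hB' : IsAbsoluteExtensor B') (cA : IsClosed A) (cB : IsClosed B)
    (φ : C(↥(A ∩ B), ↥(A' ∩ B'))) :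
    ∃ F : C(↥(A ∪ B), ↥(A' ∪ B')), (∀ x : ↥(A ∪ B), (x : E) ∈ A → (F x : E') ∈ A') ∧
      (∀ x : ↥(A ∪ B), (x : E) ∈ B → (F x : E') ∈ B') ∧
      ∀ x : ↥(A ∩ B), (F ⟨x, .inl x.2.1⟩ : E') = φ x := by
  obtain ⟨f, hf, hfφ⟩ := φ.exists_continuousOn_extension
  have hm : ∀ x ∈ A ∩ B, f x ∈ A' ∩ B' := fun x hx => by
    rw [hfφ ⟨x, hx⟩]; exact Subtype.coe_prop _
  obtain ⟨F, hF, hFA, hFB, hFf⟩ := IsAbsoluteExtensor.exists_extend_union hA' hB' cA cB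
    isClosed_empty f (by simpa using hf) (fun x hx => (hm x (by simpa using hx)).1)
    (fun x hx => (hm x (by simpa using hx.symm)).2)
  refine ⟨⟨fun x => ⟨F x, x.2.imp (fun h => hFA h) (fun h => hFB h)⟩,
    (continuousOn_iff_continuous_domRestrict.mp hF).subtype_mk _⟩, fun x h => hFA h,
    fun x h => hFB h, fun x => ?_⟩
  rw [← hfφ]
  exact hFf ⟨.inl x.2.1, .inl x.2⟩

/-- The homotopy type of a union of two closed absolute extensors is determined by the homotopy
type of their intersection. -/
theorem nonempty_homotopyEquiv_union {E E' : Type} [MetricSpace E] [MetricSpace E'] [Nonempty E]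
    [Nonempty E'] {A B : Set E} {A' B' : Set E'} (hA : IsAbsoluteExtensor A)
    (hB : IsAbsoluteExtensor B) (cA : IsClosed A) (cB : IsClosed B)
    (hA' : IsAbsoluteExtensor A') (hB' : IsAbsoluteExtensor B') (cA' : IsClosed A')
    (cB' : IsClosed B') (e : ↥(A ∩ B) ≃ₕ ↥(A' ∩ B')) :
    Nonempty (↥(A ∪ B) ≃ₕ ↥(A' ∪ B')) := by
  obtain ⟨F, hFA, hFB, hF⟩ := exists_extend_union_of_inter hA' hB' cA cB e.toFun
  obtain ⟨G, hGA, hGB, hG⟩ := exists_extend_union_of_inter hA hB cA' cB' e.invFun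
  refine ⟨⟨F, G, ?_, ?_⟩⟩
  -- On A ∩ B the composite G ∘ F is the composite of `e` with its homotopy inverse.
  · refine homotopic_id_of_union hA hB cA cB (G.comp F) (e.invFun.comp e.toFun)
      (fun x h => hGA _ (hFA x h)) (fun x h => hGB _ (hFB x h)) (fun x => ?_) e.left_inv
    rw [ContinuousMap.comp_apply, ContinuousMap.comp_apply, ← hG]
    congr 2
    exact Subtype.ext (hF x)
  · refine homotopic_id_of_union hA' hB' cA' cB' (F.comp G) (e.toFun.comp e.invFun)
      (fun x h => hFA _ (hGA x h)) (fun x h => hFB _ (hGB x h)) (fun x => ?_) e.right_inv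
    rw [ContinuousMap.comp_apply, ContinuousMap.comp_apply, ← hF]
    congr 2
    exact Subtype.ext (hG x)

/-! ### Spheres as unions of hemispheres -/

section Sphere

variable {d : ℕ}

/-- The point of `ℝ^{d+1}` with first coordinate `a` and remaining coordinates `y`. -/
def euclideanCons (a : ℝ) (y : EuclideanSpace ℝ (Fin d)) : EuclideanSpace ℝ (Fin (d + 1)) :=
  WithLp.toLp 2 (Fin.cons a y.ofLp : Fin (d + 1) → ℝ)

/-- The coordinates of a point of `ℝ^{d+1}` except the first one. -/
def euclideanTail (x : EuclideanSpace ℝ (Fin (d + 1))) : EuclideanSpace ℝ (Fin d) :=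
  WithLp.toLp 2 (Fin.tail x.ofLp : Fin d → ℝ)

theorem continuous_euclideanCons :
    Continuous fun p : ℝ × EuclideanSpace ℝ (Fin d) => euclideanCons p.1 p.2 := by
  refine (PiLp.continuous_toLp 2 _).comp (continuous_pi fun i => ?_)
  refine Fin.cases ?_ (fun i => ?_) i
  · simpa using continuous_fst
  · simp only [Fin.cons_succ]
    fun_prop

theorem continuous_euclideanTail :
    Continuous (euclideanTail : EuclideanSpace ℝ (Fin (d + 1)) → _) := by
  refine (PiLp.continuous_toLp 2 _).comp (continuous_pi fun i => ?_)
  simp only [Fin.tail]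
  fun_prop

theorem euclideanCons_tail (x : EuclideanSpace ℝ (Fin (d + 1))) :
    euclideanCons (x 0) (euclideanTail x) = x := by
  simp [euclideanCons, euclideanTail]

theorem euclideanTail_cons (a : ℝ) (y : EuclideanSpace ℝ (Fin d)) :
    euclideanTail (euclideanCons a y) = y := by
  simp [euclideanCons, euclideanTail]

theorem euclideanCons_zero (a : ℝ) (y : EuclideanSpace ℝ (Fin d)) : euclideanCons a y 0 = a := by
  simp [euclideanCons]

theorem norm_sq_euclideanCons (a : ℝ) (y : EuclideanSpace ℝ (Fin d)) :
    ‖euclideanCons a y‖ ^ 2 = a ^ 2 + ‖y‖ ^ 2 := by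
  simp [EuclideanSpace.real_norm_sq_eq, Fin.sum_univ_succ, euclideanCons]

theorem euclideanCons_mem_unitSphere (a : ℝ) (y : EuclideanSpace ℝ (Fin d)) :
    euclideanCons a y ∈ unitSphere (d + 1) ↔ a ^ 2 + ‖y‖ ^ 2 = 1 := by
  rw [mem_sphere_zero_iff_norm, ← norm_sq_euclideanCons,
    pow_eq_one_iff_of_nonneg (norm_nonneg _) two_ne_zero]

/-- The hemisphere of `S^d` on which the first coordinate has the sign of `σ`. -/
def hemisphere (d : ℕ) (σ : ℝ) : Set (EuclideanSpace ℝ (Fin (d + 1))) :=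
  {x | x ∈ unitSphere (d + 1) ∧ 0 ≤ σ * x 0}

theorem isClosed_hemisphere (d : ℕ) (σ : ℝ) : IsClosed (hemisphere d σ) :=
  Metric.isClosed_sphere.inter
    (isClosed_le (f := fun _ => 0) (g := fun x : EuclideanSpace ℝ (Fin (d + 1)) => σ * x 0)
      continuous_const (by fun_prop))

/-- The hemisphere is a graph over the unit ball: retract the tail radially onto the ball, then lift
it back. -/
theorem isAbsoluteExtensor_hemisphere (d : ℕ) {σ : ℝ} (hσ : σ ^ 2 = 1) :
    IsAbsoluteExtensor (hemisphere d σ) := by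
  have hc : Continuous fun x : EuclideanSpace ℝ (Fin (d + 1)) =>
      (max 1 ‖euclideanTail x‖)⁻¹ • euclideanTail x := by
    have := continuous_euclideanTail (d := d)
    have h : Continuous fun x : EuclideanSpace ℝ (Fin (d + 1)) => max 1 ‖euclideanTail x‖ := by
      fun_prop
    exact (h.inv₀ fun x => by positivity).smul this
  have hn : ∀ t : EuclideanSpace ℝ (Fin d), ‖(max 1 ‖t‖)⁻¹ • t‖ ≤ 1 := by
    intro t
    have : 0 < max 1 ‖t‖ := by positivity
    rw [norm_smul, Real.norm_of_nonneg (by positivity), inv_mul_le_iff₀ this, mul_one]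
    exact le_max_right _ _
  refine IsAbsoluteExtensor.of_retraction (fun x =>
    euclideanCons (σ * √(1 - ‖(max 1 ‖euclideanTail x‖)⁻¹ • euclideanTail x‖ ^ 2))
      ((max 1 ‖euclideanTail x‖)⁻¹ • euclideanTail x)) ?_ ?_ ?_
  · exact continuous_euclideanCons.comp (f := fun x => (_, _)) (by fun_prop)
  · intro x
    have h := hn (euclideanTail x)
    set y := (max 1 ‖euclideanTail x‖)⁻¹ • euclideanTail x
    have h' : 0 ≤ 1 - ‖y‖ ^ 2 := by nlinarith [norm_nonneg y]
    refine ⟨?_, ?_⟩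
    · rw [euclideanCons_mem_unitSphere, mul_pow, hσ, Real.sq_sqrt h']
      ring
    · rw [euclideanCons_zero, ← mul_assoc, ← sq, hσ, one_mul]
      exact Real.sqrt_nonneg _
  · rintro x ⟨hx, h0⟩
    rw [← euclideanCons_tail x] at hx
    rw [euclideanCons_mem_unitSphere] at hx
    have h1 : ‖euclideanTail x‖ ≤ 1 := by nlinarith [sq_nonneg (x 0)]
    have h2 : σ * √(1 - ‖euclideanTail x‖ ^ 2) = x 0 := by
      have : 1 - ‖euclideanTail x‖ ^ 2 = (σ * x 0) ^ 2 := by rw [mul_pow, hσ]; linarith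
      rw [this, Real.sqrt_sq h0, ← mul_assoc, ← sq, hσ, one_mul]
    simp only [max_eq_left h1, inv_one, one_smul, h2, euclideanCons_tail]

theorem hemisphere_union (d : ℕ) : hemisphere d 1 ∪ hemisphere d (-1) = unitSphere (d + 1) := by
  ext x
  simp only [hemisphere, Set.mem_union, Set.mem_ofPred_eq]
  have := le_total 0 (x 0)
  simp
  tauto

/-- The equator of `S^d` is `S^{d-1}`. -/
def equatorHomeomorph (d : ℕ) :
    ↥(hemisphere d 1 ∩ hemisphere d (-1)) ≃ₜ unitSphere d := by
  have h0 : ∀ x ∈ hemisphere d 1 ∩ hemisphere d (-1), x 0 = 0 := by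
    rintro x ⟨⟨-, h1⟩, -, h2⟩
    linarith
  have h1 : ∀ x ∈ hemisphere d 1 ∩ hemisphere d (-1), euclideanTail x ∈ unitSphere d := by
    intro x hx
    have h := hx.1.1
    rw [← euclideanCons_tail x, euclideanCons_mem_unitSphere, h0 _ hx] at h
    rw [mem_sphere_zero_iff_norm]
    nlinarith [norm_nonneg (euclideanTail x)]
  have h2 : ∀ y ∈ unitSphere d, euclideanCons 0 y ∈ hemisphere d 1 ∩ hemisphere d (-1) := by
    intro y hy
    have h : euclideanCons 0 y ∈ unitSphere (d + 1) := by
      rw [euclideanCons_mem_unitSphere, mem_sphere_zero_iff_norm.mp hy]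
      norm_num
    exact ⟨⟨h, by rw [euclideanCons_zero, mul_zero]⟩, ⟨h, by rw [euclideanCons_zero, mul_zero]⟩⟩
  exact
    { toFun := fun x => ⟨euclideanTail x.1, h1 _ x.2⟩
      invFun := fun y => ⟨euclideanCons 0 y.1, h2 _ y.2⟩
      left_inv := fun x => by
        ext1
        have := euclideanCons_tail x.1
        rwa [h0 _ x.2] at this
      right_inv := fun y => Subtype.ext (euclideanTail_cons _ _)
      continuous_toFun := (continuous_euclideanTail.comp continuous_subtype_val).subtype_mk
        fun x => h1 _ x.2
      continuous_invFun := (continuous_euclideanCons.comp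
        (Continuous.prodMk continuous_const continuous_subtype_val)).subtype_mk fun y => h2 _ y.2 }

/-- A union of two closed absolute extensors is a sphere, up to homotopy, if their intersection
is a sphere of one dimension less. -/
theorem nonempty_homotopyEquiv_unitSphere_succ {E : Type} [MetricSpace E] [Nonempty E]
    {A B : Set E} (hA : IsAbsoluteExtensor A) (hB : IsAbsoluteExtensor B) (cA : IsClosed A)
    (cB : IsClosed B) (h : Nonempty (↥(A ∩ B) ≃ₕ unitSphere d)) :
    Nonempty (↥(A ∪ B) ≃ₕ unitSphere (d + 1)) := by
  obtain ⟨e⟩ := h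
  rw [← hemisphere_union]
  exact nonempty_homotopyEquiv_union hA hB cA cB
    (isAbsoluteExtensor_hemisphere d (by norm_num)) (isAbsoluteExtensor_hemisphere d (by norm_num))
    (isClosed_hemisphere _ _) (isClosed_hemisphere _ _)
    (e.trans (equatorHomeomorph d).symm.toHomotopyEquiv)

end Sphere

/-! ### Faces of the simplex -/

section Face

variable {ι : Type} [Fintype ι]

/-- The face of the standard simplex spanned by the vertices in `F`. -/
def simplexFace (F : Set ι) : Set (ι → ℝ) :=
  {x | x ∈ stdSimplex ℝ ι ∧ ∀ i, i ∉ F → x i = 0}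

theorem isClosed_simplexFace (F : Set ι) : IsClosed (simplexFace F) := by
  have : simplexFace F = stdSimplex ℝ ι ∩ ⋂ i, ⋂ _ : i ∉ F, {x | x i = 0} := by
    ext x
    simp [simplexFace]
  rw [this]
  exact (isClosed_stdSimplex ℝ ι).inter (isClosed_iInter fun i => isClosed_iInter fun _ =>
    isClosed_eq (continuous_apply i) continuous_const)

theorem simplexFace_inter (F G : Set ι) :
    simplexFace F ∩ simplexFace G = simplexFace (F ∩ G) := by
  ext x
  simp only [simplexFace, Set.mem_inter_iff, Set.mem_ofPred_eq]
  constructor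
  · rintro ⟨⟨h, hF⟩, -, hG⟩
    exact ⟨h, fun i hi => by by_cases h : i ∈ F <;> [exact hG i fun h' => hi ⟨h, h'⟩; exact hF i h]⟩
  · rintro ⟨h, hFG⟩
    exact ⟨⟨h, fun i hi => hFG i fun h => hi h.1⟩, h, fun i hi => hFG i fun h => hi h.2⟩

theorem simplexFace_mono {F G : Set ι} (h : F ⊆ G) : simplexFace F ⊆ simplexFace G :=
  fun _ hx => ⟨hx.1, fun i hi => hx.2 i fun hF => hi (h hF)⟩

theorem simplexFace_empty : simplexFace (∅ : Set ι) = ∅ := by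
  refine Set.eq_empty_of_forall_notMem fun x hx => ?_
  have := hx.1.2
  simp [fun i => hx.2 i (Set.notMem_empty i)] at this

theorem single_mem_simplexFace [DecidableEq ι] {F : Set ι} {v : ι} (hv : v ∈ F) :
    Pi.single v 1 ∈ simplexFace F := by
  refine ⟨single_mem_stdSimplex ℝ v, fun i hi => ?_⟩
  have : i ≠ v := fun h => hi (h ▸ hv)
  exact Pi.single_eq_of_ne this 1

theorem isAbsoluteExtensor_simplexFace {F : Set ι} (hF : F.Nonempty) :
    IsAbsoluteExtensor (simplexFace F) := by
  classical
  obtain ⟨v, hv⟩ := hF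
  let p : (ι → ℝ) → ι → ℝ := fun x i => if i ∈ F then max (x i) 0 else 0
  let s : (ι → ℝ) → ℝ := fun x => ∑ i, p x i
  have hp : Continuous p := by
    refine continuous_pi fun i => ?_
    by_cases h : i ∈ F
    · simp only [p, if_pos h]; fun_prop
    · simp only [p, if_neg h]; fun_prop
  have hp0 : ∀ x i, 0 ≤ p x i := fun x i => by
    simp only [p]; split_ifs <;> simp
  have hs : Continuous s := by fun_prop
  have hm : ∀ x, 0 < max (s x) 1 := fun x => by positivity
  -- Keep the positive parts on F, put any mass missing from 1 on v, and divide by the resulting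
  -- total max(s, 1).
  refine IsAbsoluteExtensor.of_retraction
    (fun x => (max (s x) 1)⁻¹ • (p x + max (1 - s x) 0 • Pi.single v 1)) ?_ ?_ ?_
  · exact Continuous.smul (Continuous.inv₀ (by fun_prop) fun x => (hm x).ne') (by fun_prop)
  · refine fun x => ⟨⟨fun i => ?_, ?_⟩, fun i hi => ?_⟩
    · have h1 : 0 ≤ (Pi.single v 1 : ι → ℝ) i := by
        by_cases h : i = v
        · subst h; simp
        · simp [h]
      have := hp0 x i
      have := hm x
      simp only [Pi.smul_apply, Pi.add_apply, smul_eq_mul]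
      positivity
    · simp only [Pi.smul_apply, Pi.add_apply, smul_eq_mul, ← Finset.mul_sum,
        Finset.sum_add_distrib, Finset.sum_pi_single', Finset.mem_univ, if_true, mul_one]
      rw [inv_mul_eq_one₀ (hm x).ne']
      change _ = s x + _
      rcases le_total (s x) 1 with h | h
      · rw [max_eq_right h, max_eq_left (by linarith)]; ring
      · rw [max_eq_left h, max_eq_right (by linarith)]; ring
    · have : i ≠ v := fun h => hi (h ▸ hv)
      simp [p, hi, this]
  · rintro x ⟨⟨h0, h1⟩, hx⟩
    have hpx : p x = x := by
      ext i
      by_cases h : i ∈ F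
      · simp only [p, if_pos h, max_eq_left (h0 i)]
      · simp only [p, if_neg h, hx i h]
    have hsx : s x = 1 := by simp only [s, hpx, h1]
    simp [hpx, hsx]

/-- A union of faces of a simplex that share a vertex is an absolute extensor. -/
theorem isAbsoluteExtensor_biUnion_simplexFace {σ : Type*} (v : ι) (s : Finset σ)
    (hs : s.Nonempty) (F : σ → Set ι) (hv : ∀ i ∈ s, v ∈ F i) :
    IsAbsoluteExtensor (⋃ i ∈ s, simplexFace (F i)) := by
  classical
  induction hs using Finset.Nonempty.cons_induction generalizing F with
  | singleton a => simpa using isAbsoluteExtensor_simplexFace ⟨v, hv a (by simp)⟩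
  | cons a s ha hs ih =>
    rw [Finset.cons_eq_insert, Finset.set_biUnion_insert]
    refine IsAbsoluteExtensor.union (isAbsoluteExtensor_simplexFace ⟨v, hv a (by simp)⟩)
      (ih F fun i hi => hv i (by simp [hi])) ?_ (isClosed_simplexFace _)
      (s.finite_toSet.isClosed_biUnion fun i _ => isClosed_simplexFace _)
    -- The intersection is again a union of faces through v, indexed by the smaller set; hence the
    -- induction over all F.
    simp only [Set.inter_iUnion, simplexFace_inter]
    exact ih _ fun i hi => ⟨hv a (by simp), hv i (by simp [hi])⟩

end Face

/-! ### The recursion for the path complex, in a fixed ambient simplex -/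

section PathComplex

variable (N k : ℕ)

/-- The union of the faces of the simplex on `Fin N` spanned by the complements in
`{0, …, n - 1}` of the blocks `{i, …, i + k - 1}` with `i + k < n`. -/
def blockComplements (n : ℕ) : Set (Fin N → ℝ) :=
  ⋃ i ∈ Finset.range (n - k),
    simplexFace {a : Fin N | (a : ℕ) < n ∧ ¬(i ≤ (a : ℕ) ∧ (a : ℕ) < i + k)}

/-- The face of the simplex on `Fin N` spanned by the first `n - j` vertices. -/
def initialFace (n j : ℕ) : Set (Fin N → ℝ) :=
  simplexFace {a : Fin N | (a : ℕ) + j < n}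

/-- The realization of the noncover complex of the generalized tight path on the first `n`
vertices, inside the simplex on `Fin N`. -/
def pathComplex (n j : ℕ) : Set (Fin N → ℝ) :=
  blockComplements N k n ∪ initialFace N n j

variable {N k}

theorem isClosed_blockComplements (n : ℕ) : IsClosed (blockComplements N k n) :=
  (Finset.finite_toSet _).isClosed_biUnion fun _ _ => isClosed_simplexFace _

theorem isClosed_initialFace (n j : ℕ) : IsClosed (initialFace N n j) :=
  isClosed_simplexFace _

theorem isAbsoluteExtensor_blockComplements {n : ℕ} (hkn : k < n) (hnN : n ≤ N) :
    IsAbsoluteExtensor (blockComplements N k n) := by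
  refine isAbsoluteExtensor_biUnion_simplexFace ⟨n - 1, by omega⟩ _
    (Finset.nonempty_range_iff.mpr (by omega)) _ ?_
  intro i hi
  rw [Finset.mem_range] at hi
  change n - 1 < n ∧ ¬(i ≤ n - 1 ∧ n - 1 < i + k)
  omega

theorem isAbsoluteExtensor_initialFace {n j : ℕ} (hjn : j < n) (hnN : n ≤ N) :
    IsAbsoluteExtensor (initialFace N n j) :=
  isAbsoluteExtensor_simplexFace ⟨⟨0, by omega⟩, by change 0 + j < n; omega⟩

theorem blockComplements_inter_initialFace {n j : ℕ} (hj : 1 ≤ j) (hjk : j ≤ k) (hkn : k < n) :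
    blockComplements N k n ∩ initialFace N n j = pathComplex N k (n - j) (k + 1 - j) := by
  simp only [blockComplements, pathComplex, initialFace, Set.iUnion_inter, simplexFace_inter]
  apply subset_antisymm
  · refine Set.iUnion₂_subset fun i hi => ?_
    rw [Finset.mem_range] at hi
    -- A block ending before n - j - 1 is an edge of the smaller path. Any other leaves only the
    -- vertices below i ≤ n - k - 1, which lie in the smaller initial face.
    by_cases h : i + k < n - j
    · refine Set.subset_union_of_subset_left (Set.subset_iUnion₂_of_subset i
        (Finset.mem_range.mpr (by omega)) (simplexFace_mono ?_)) _
      rintro a ⟨⟨h1, h2⟩, h3 : (a : ℕ) + j < n⟩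
      exact ⟨by omega, h2⟩
    · refine Set.subset_union_of_subset_right (simplexFace_mono ?_) _
      rintro a ⟨⟨h1, h2⟩, h3 : (a : ℕ) + j < n⟩
      change (a : ℕ) + (k + 1 - j) < n - j
      omega
  · refine Set.union_subset (Set.iUnion₂_subset fun i hi => ?_) ?_
    · rw [Finset.mem_range] at hi
      refine Set.subset_iUnion₂_of_subset i (Finset.mem_range.mpr (by omega)) (simplexFace_mono ?_)
      rintro a ⟨h1, h2⟩
      exact ⟨⟨by omega, h2⟩, by change (a : ℕ) + j < n; omega⟩
    -- The last remaining block ends at n - 2, so among the first n - j vertices its complement is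
    -- exactly those below n - k - 1.
    · refine Set.subset_iUnion₂_of_subset (n - k - 1) (Finset.mem_range.mpr (by omega))
        (simplexFace_mono ?_)
      rintro a (h : (a : ℕ) + (k + 1 - j) < n - j)
      exact ⟨⟨by omega, by omega⟩, by change (a : ℕ) + j < n; omega⟩

theorem blockComplements_eq_empty {n : ℕ} (h : n ≤ k) : blockComplements N k n = ∅ := by
  simp [blockComplements, Nat.sub_eq_zero_of_le h]

theorem pathComplex_self {j : ℕ} (hjk : j ≤ k) : pathComplex N k j j = ∅ := by
  have : {a : Fin N | (a : ℕ) + j < j} = ∅ := by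
    ext a
    simp
  rw [pathComplex, blockComplements_eq_empty hjk, initialFace, this, simplexFace_empty,
    Set.union_empty]

theorem pathComplex_nonempty {n j : ℕ} (hjn : j < n) (hnN : n ≤ N) :
    (pathComplex N k n j).Nonempty :=
  ⟨_, .inr (single_mem_simplexFace (v := ⟨0, by omega⟩) (by change 0 + j < n; omega))⟩

theorem isClosed_pathComplex (n j : ℕ) : IsClosed (pathComplex N k n j) :=
  (isClosed_blockComplements n).union (isClosed_initialFace n j)

theorem isAbsoluteExtensor_pathComplex {n j : ℕ} (hj : 1 ≤ j) (hjk : j ≤ k) (hjn : j ≤ n)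
    (hnN : n ≤ N) (h : ∀ q : ℕ, n ≠ (q + 1) * (k + 1) ∧ n ≠ q * (k + 1) + j) :
    IsAbsoluteExtensor (pathComplex N k n j) := by
  induction n using Nat.strong_induction_on generalizing j with
  | _ n ih =>
    have hjn' : j < n := lt_of_le_of_ne hjn fun e => (h 0).2 (by omega)
    rcases le_or_gt n k with hnk | hkn
    · rw [pathComplex, blockComplements_eq_empty hnk, Set.empty_union]
      exact isAbsoluteExtensor_initialFace hjn' hnN
    · refine IsAbsoluteExtensor.union (isAbsoluteExtensor_blockComplements hkn hnN)
        (isAbsoluteExtensor_initialFace hjn' hnN) ?_ (isClosed_blockComplements n)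
        (isClosed_initialFace n j)
      rw [blockComplements_inter_initialFace hj hjk hkn]
      -- The excluded forms for (n - j, k + 1 - j) are those for (n, j), exchanged.
      refine ih (n - j) (by omega) (by omega) (by omega) (by omega) (by omega) fun q => ⟨?_, ?_⟩
      · intro e
        exact (h (q + 1)).2 (by omega)
      · intro e
        refine (h q).1 ?_
        rw [add_mul, one_mul]
        omega

theorem nonempty_homotopyEquiv_pathComplex_succ {n j d : ℕ} (hj : 1 ≤ j) (hjk : j ≤ k)
    (hkn : k < n) (hnN : n ≤ N)
    (h : Nonempty (pathComplex N k (n - j) (k + 1 - j) ≃ₕ unitSphere d)) :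
    Nonempty (pathComplex N k n j ≃ₕ unitSphere (d + 1)) :=
  nonempty_homotopyEquiv_unitSphere_succ (isAbsoluteExtensor_blockComplements hkn hnN)
    (isAbsoluteExtensor_initialFace (by omega) hnN) (isClosed_blockComplements n)
    (isClosed_initialFace n j)
    (by rwa [blockComplements_inter_initialFace hj hjk hkn])

theorem nonempty_homotopyEquiv_pathComplex_odd {q : ℕ}
    (ih : ∀ n j : ℕ, 1 ≤ j → j ≤ k → n ≤ N → n = q * (k + 1) + j →
      Nonempty (pathComplex N k n j ≃ₕ unitSphere (2 * q)))
    {n j : ℕ} (hj : 1 ≤ j) (hjk : j ≤ k) (hnN : n ≤ N) (hn : n = (q + 1) * (k + 1)) :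
    Nonempty (pathComplex N k n j ≃ₕ unitSphere (2 * q + 1)) := by
  rw [add_mul, one_mul] at hn
  exact nonempty_homotopyEquiv_pathComplex_succ hj hjk (by omega) hnN
    (ih _ _ (by omega) (by omega) (by omega) (by omega))

theorem nonempty_homotopyEquiv_pathComplex_even (q : ℕ) :
    ∀ n j : ℕ, 1 ≤ j → j ≤ k → n ≤ N → n = q * (k + 1) + j →
      Nonempty (pathComplex N k n j ≃ₕ unitSphere (2 * q)) := by
  induction q with
  | zero =>
    rintro n j hj hjk hnN hn
    obtain rfl : n = j := by omega
    have h1 : IsEmpty (pathComplex N k n n) := by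
      rw [pathComplex_self hjk]
      infer_instance
    have h2 : IsEmpty (unitSphere (2 * 0)) := by
      refine ⟨fun x => ?_⟩
      have := mem_sphere_zero_iff_norm.mp x.2
      have h0 : x.1 = 0 := by ext i; exact absurd i.2 (by simp)
      rw [h0, norm_zero] at this
      exact zero_ne_one this
    exact ⟨(Homeomorph.empty).toHomotopyEquiv⟩
  | succ q ih =>
    intro n j hj hjk hnN hn
    have hn' := hn
    rw [add_mul, one_mul] at hn'
    exact nonempty_homotopyEquiv_pathComplex_succ hj hjk (by omega) hnN
      (nonempty_homotopyEquiv_pathComplex_odd ih (by omega) (by omega) (by omega) (by omega))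

end PathComplex

/-! ### From the noncover complex to the path complex -/

section NoncoverComplex

variable {n k j : ℕ}

theorem Hypergraph.mem_noncoverComplex_iff {V : Type*} {H : Hypergraph V}
    (hH : H.vertexSet = Set.univ) {W : Finset V} :
    W ∈ H.noncoverComplex ↔ ∃ e ∈ H.edgeSet, ∀ v ∈ e, v ∉ W := by
  change (_ ∧ ¬ (_ ∧ _)) ↔ _
  simp only [hH, Set.subset_univ, true_and, not_forall, Set.not_nonempty_iff_eq_empty,
    exists_prop]
  refine exists_congr fun e => and_congr_right fun _ => ?_
  rw [← Set.disjoint_iff_inter_eq_empty, Set.disjoint_right]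
  simp

theorem Hypergraph.mem_geometricRealization_noncoverComplex_iff {V : Type*} [Fintype V]
    {H : Hypergraph V} (hH : H.vertexSet = Set.univ) {x : V → ℝ} :
    x ∈ geometricRealization H.noncoverComplex ↔
      x ∈ stdSimplex ℝ V ∧ ∃ e ∈ H.edgeSet, ∀ v ∈ e, x v = 0 := by
  classical
  refine and_congr_right fun _ => ⟨?_, ?_⟩
  · rintro ⟨s, hs, hxs⟩
    obtain ⟨e, he, hes⟩ := (mem_noncoverComplex_iff hH).mp hs
    exact ⟨e, he, fun v hv => by_contra fun h => hes v hv (by simpa using hxs h)⟩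
  · rintro ⟨e, he, hxe⟩
    refine ⟨Finset.univ.filter fun v => x v ≠ 0,
      (mem_noncoverComplex_iff hH).mpr ⟨e, he, fun v hv => ?_⟩, fun v hv => ?_⟩
    · simp [hxe v hv]
    · simpa using hv

/-- Deleting the last block removes just i = n - k: as k ≥ 1, blocks are nonempty and their first
vertex determines i. -/
theorem mem_edgeSet_generalizedTightPath_iff (hk : 1 ≤ k) {e : Set (Fin n)} :
    e ∈ (generalizedTightPath n k j).edgeSet ↔
      (∃ i, i + k < n ∧ e = block n i k) ∨ (j ≤ n ∧ e = block n (n - j) j) := by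
  refine or_congr ⟨?_, ?_⟩ Iff.rfl
  · rintro ⟨⟨i, hi, rfl⟩, hne⟩
    refine ⟨i, lt_of_le_of_ne hi fun h => hne ⟨by omega, ?_⟩, rfl⟩
    rw [← h, Nat.add_sub_cancel]
  · rintro ⟨i, hi, rfl⟩
    refine ⟨⟨i, hi.le, rfl⟩, fun ⟨_, h⟩ => ?_⟩
    have h1 : (⟨i, by omega⟩ : Fin n) ∈ block n i k := ⟨le_rfl, Nat.lt_add_of_pos_right hk⟩
    rw [h] at h1
    have h2 : n - k ≤ i := h1.1
    omega

theorem geometricRealization_generalizedTightPath (hk : 1 ≤ k) (hjn : j ≤ n) :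
    geometricRealization (generalizedTightPath n k j).noncoverComplex = pathComplex n k n j := by
  ext x
  rw [Hypergraph.mem_geometricRealization_noncoverComplex_iff rfl]
  simp only [mem_edgeSet_generalizedTightPath_iff hk, pathComplex, blockComplements, initialFace,
    Set.mem_union, Set.mem_iUnion, Finset.mem_range, exists_prop]
  constructor
  · rintro ⟨hx, e, ⟨i, hi, rfl⟩ | ⟨-, rfl⟩, he⟩
    · refine .inl ⟨i, by omega, hx, fun a ha => he a ?_⟩
      by_contra h
      exact ha ⟨a.2, h⟩
    · refine .inr ⟨hx, fun a (ha : ¬ (a : ℕ) + j < n) => he a ?_⟩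
      exact ⟨by omega, by omega⟩
  · rintro (⟨i, hi, hx, h⟩ | ⟨hx, h⟩)
    · exact ⟨hx, _, .inl ⟨i, by omega, rfl⟩, fun a ha => h a fun h' => h'.2 ha⟩
    · refine ⟨hx, _, .inr ⟨hjn, rfl⟩, fun a ha => h a ?_⟩
      have h1 : n - j ≤ (a : ℕ) := ha.1
      change ¬ (a : ℕ) + j < n
      omega

end NoncoverComplex

/-! ### The theorem -/

theorem mainTheorem4 (n k j : ℕ) (hn : 1 ≤ n) (hj : 1 ≤ j) (hjk : j ≤ k) :
    (n < j → (generalizedTightPath n k j).noncoverComplex = ⊥) ∧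
    (j ≤ n →
      (∀ q : ℕ, n = (q + 1) * (k + 1) →
        Nonempty (geometricRealization (generalizedTightPath n k j).noncoverComplex ≃ₕ
          unitSphere (2 * q + 1))) ∧
      (∀ q : ℕ, n = q * (k + 1) + j →
        Nonempty (geometricRealization (generalizedTightPath n k j).noncoverComplex ≃ₕ
          unitSphere (2 * q))) ∧
      (n = j → ((generalizedTightPath n k j).noncoverComplex : Set (Finset (Fin n))) = {∅}) ∧
      ((∀ q : ℕ, n ≠ (q + 1) * (k + 1) ∧ n ≠ q * (k + 1) + j) →
        ContractibleSpace
          (geometricRealization (generalizedTightPath n k j).noncoverComplex))) := by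
  have hk : 1 ≤ k := hj.trans hjk
  refine ⟨fun hnj => ?_, fun hjn => ?_⟩
  · refine le_bot_iff.mp fun W hW => ?_
    obtain ⟨e, he, -⟩ := (Hypergraph.mem_noncoverComplex_iff rfl).mp hW
    rcases (mem_edgeSet_generalizedTightPath_iff hk).mp he with ⟨i, hi, -⟩ | ⟨h, -⟩ <;> omega
  rw [geometricRealization_generalizedTightPath hk hjn]
  refine ⟨fun q hq => ?_, fun q hq => ?_, ?_, fun h => ?_⟩
  · exact nonempty_homotopyEquiv_pathComplex_odd (nonempty_homotopyEquiv_pathComplex_even q)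
      hj hjk le_rfl hq
  · exact nonempty_homotopyEquiv_pathComplex_even q n j hj hjk le_rfl hq
  · rintro rfl
    ext W
    rw [SetLike.mem_coe, Hypergraph.mem_noncoverComplex_iff rfl, Set.mem_singleton_iff]
    constructor
    · rintro ⟨e, he, hW⟩
      rcases (mem_edgeSet_generalizedTightPath_iff hk).mp he with ⟨i, hi, -⟩ | ⟨-, rfl⟩
      · omega
      · refine Finset.eq_empty_of_forall_notMem fun v => hW v ?_
        exact ⟨by omega, by omega⟩
    · rintro rfl
      exact ⟨_, (mem_edgeSet_generalizedTightPath_iff hk).mpr (.inr ⟨le_rfl, rfl⟩), by simp⟩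
  · exact (isAbsoluteExtensor_pathComplex hj hjk hjn le_rfl h).contractibleSpace
      (isClosed_pathComplex n j)
      (pathComplex_nonempty (lt_of_le_of_ne hjn fun e => (h 0).2 (by omega)) le_rfl)
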